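/- Let $\vartheta>0$ and $\alpha\ge 0$ be real numbers, and for $\gamma>0$ put $$R(\gamma)=\ln(1+\gamma)-\vartheta\sqrt{1-\frac{1}{(1+\gamma)^2}} .$$ For integers $m\ge 0$ let $$\mathcal{B}_m(z)=\sum_{k=0}^{m}\frac{(m+k)!}{k!\,(m-k)!}\left(\frac z2\right)^k ,$$ and let $$\mathcal{W}(\iota_1,\iota_2;\mu)=\iota_1-\sum_{m=1}^{\infty}\frac{1}{m\cdot m!}\left(\frac{\mu\, m\, e^{-\iota_1}}{\iota_2-\iota_1}\right)^{m}\mathcal{B}_{m-1}\!\left(\frac{-2}{m(\iota_2-\iota_1)}\right).$$ Then the series for $\kappa^*:=\mathcal{W}\bigl(2\vartheta,-2\vartheta;-4e^{-2\alpha}\vartheta^2\bigr)$ converges, $\kappa^*$ is the unique solution in the interval $(0,2\vartheta]$ of $$e^{\kappa}(\kappa-2\vartheta)(\kappa+2\vartheta)=-4e^{-2\alpha}\vartheta^2 ,$$ and the equation $R(\gamma)=\alpha$ has exactly one solution in the range $\gamma>0$, namely $$\gamma^*=e^{\alpha+\kappa^*/2}-1 .$$ -/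

import Mathlib

open Finset
open scoped Nat

noncomputable section

namespace URLLC

/-- Shannon capacity `C(γ) = ln (1 + γ)`. -/
def capacity (γ : ℝ) : ℝ := Real.log (1 + γ)

/-- Channel dispersion `V(γ) = 1 - 1 / (1 + γ)²`. -/
def dispersion (γ : ℝ) : ℝ := 1 - 1 / (1 + γ) ^ 2

/-- Finite-blocklength achievable rate `R(γ) = C(γ) - ϑ √V(γ)`. -/
def rate (ϑ γ : ℝ) : ℝ := capacity γ - ϑ * Real.sqrt (dispersion γ)

/-- Bessel-type polynomial `𝓑ₘ(z) = ∑_{k=0}^m (m+k)! / (k! (m-k)!) (z/2)^k`. -/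
def besselPoly (m : ℕ) (z : ℝ) : ℝ :=
  ∑ k ∈ range (m + 1), ((m + k)! : ℝ) / ((k ! : ℝ) * ((m - k)! : ℝ)) * (z / 2) ^ k

/-- The `m`-th term (`m ≥ 1`) of the generalized Lambert `W` series with upper parameters
`ι₁, ι₂` and argument `μ`. -/
def lambertTerm (ι₁ ι₂ μ : ℝ) (m : ℕ) : ℝ :=
  1 / ((m : ℝ) * (m ! : ℝ)) * (μ * (m : ℝ) * Real.exp (-ι₁) / (ι₂ - ι₁)) ^ m *
    besselPoly (m - 1) (-2 / ((m : ℝ) * (ι₂ - ι₁)))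

/-- The series `𝓦(ι₁, ι₂; μ) = ι₁ - ∑_{m ≥ 1} lambertTerm ι₁ ι₂ μ m`. -/
def lambertW (ι₁ ι₂ μ : ℝ) : ℝ := ι₁ - ∑' j : ℕ, lambertTerm ι₁ ι₂ μ (j + 1)

end URLLC

end

/-! ### Lagrange inversion with a quantitative radius of convergence. -/

namespace LagrangeInversion

open Metric Filter Topology Complex
open scoped Real

/-! Put `a = 2ϑ`, `F z = e^z (z - a)(z + a)` and `u z = e^(-z) / (z + a)`, so that `F z * u z = z -
a`. The series `𝓦(a, -a; ·)` is the Lagrange inversion of `F` at `a` (`coeff_localInverse`,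
`coeff_lambertKernel_mul_pow`). Cauchy's estimate on the disc of radius `a - s` about `a` gives
convergence for `|w| < e^s (a² - s²)`, and `F` inverts the series on all of that disc by the
identity theorem (`apply_series`). The argument satisfies `|μ| ≤ a²`. Since `e^s (a² - s²)` exceeds
`a²` for some `s` in `(0, a)`, the value `κ*` exists and solves the equation. Continuity from `𝓦(0)
= a` keeps it above `s > 0` (`lt_lambertW`), and convexity of `exp` makes the positive root unique
(`eq_of_exp_mul_eq`). The substitution `1 + γ = e^(α + κ/2)` transfers this to the rate
(`rate_eq_iff`). -/

lemma eventually_forall_closedBall {P : ℂ → Prop} {a : ℂ} (h : ∀ᶠ z in 𝓝 a, P z) :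
    ∀ᶠ r in 𝓝[>] (0 : ℝ), ∀ z ∈ closedBall a r, P z := by
  obtain ⟨ε, hε, hP⟩ := Metric.eventually_nhds_iff_ball.1 h
  filter_upwards [Ioo_mem_nhdsGT hε] with r hr z hz
  exact hP z (closedBall_subset_ball hr.2 hz)

variable {F u h G : ℂ → ℂ} {a : ℂ} {p : FormalMultilinearSeries ℂ ℂ ℂ}

lemma apply_eq_zero (hu0 : u a ≠ 0) (hFu : ∀ᶠ z in 𝓝 a, F z * u z = z - a) : F a = 0 := by
  simpa [hu0] using hFu.self_of_nhds

lemma deriv_mul_eq_one (hF : AnalyticAt ℂ F a) (hu : AnalyticAt ℂ u a) (hu0 : u a ≠ 0)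
    (hFu : ∀ᶠ z in 𝓝 a, F z * u z = z - a) : deriv F a * u a = 1 := by
  have h1 := (hF.differentiableAt.hasDerivAt.mul hu.differentiableAt.hasDerivAt)
  have h2 : HasDerivAt (F * u) 1 a :=
    ((hasDerivAt_id a).sub_const a).congr_of_eventuallyEq hFu
  have := h1.unique h2
  simpa [apply_eq_zero hu0 hFu] using this

/-- Pulling back along a local biholomorphism `F` with `F a = 0`, the residues at `a` of
`h(F) F' / F ^ (m + 1)` are the Taylor coefficients of `h`. -/
lemma eventually_circleIntegral_comp_eq_coeff (hF : AnalyticAt ℂ F a) (hu : AnalyticAt ℂ u a)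
    (hu0 : u a ≠ 0) (hFu : ∀ᶠ z in 𝓝 a, F z * u z = z - a) (hh : HasFPowerSeriesAt h p 0)
    (m : ℕ) :
    ∀ᶠ r in 𝓝[>] (0 : ℝ), (∮ z in C(a, r), h (F z) * deriv F z / F z ^ (m + 1)) =
      2 * π * I * p.coeff m := by
  have hFa := apply_eq_zero hu0 hFu
  have hhF (h : ℂ → ℂ) (hh : AnalyticAt ℂ h 0) : ∀ᶠ z in 𝓝 a, AnalyticAt ℂ h (F z) :=
    hF.continuousAt.eventually (by simpa [hFa] using hh.eventually_analyticAt)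
  induction m generalizing h p with
  | zero =>
    filter_upwards [self_mem_nhdsWithin, eventually_forall_closedBall hFu,
      eventually_forall_closedBall (hhF h hh.analyticAt),
      eventually_forall_closedBall hF.eventually_analyticAt,
      eventually_forall_closedBall hu.eventually_analyticAt] with r hr h1 h2 h3 h4
    have hr : 0 < r := hr
    -- Since `1 / F = u / (z - a)` on the circle, Cauchy's formula applies, and `F' u = 1` at `a`.
    have hd : DifferentiableOn ℂ (fun z => h (F z) * deriv F z * u z) (closedBall a r) := by
      intro z hz
      refine DifferentiableAt.differentiableWithinAt ?_
      exact (((h2 z hz).differentiableAt.comp z (h3 z hz).differentiableAt).mul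
        (h3 z hz).deriv.differentiableAt).mul (h4 z hz).differentiableAt
    have key := (hd.mono closure_ball_subset_closedBall).diffContOnCl.circleIntegral_sub_inv_smul
      (mem_ball_self hr)
    rw [hFa, mul_assoc (h 0), deriv_mul_eq_one hF hu hu0 hFu, mul_one] at key
    rw [show p.coeff 0 = h 0 from hh.coeff_zero 1, ← smul_eq_mul, ← key]
    refine circleIntegral.integral_congr hr.le fun z hz => ?_
    have hza : z - a ≠ 0 := sub_ne_zero.2 (ne_of_mem_sphere hz hr.ne')
    have h5 := h1 z (sphere_subset_closedBall hz)
    have hFz : F z ≠ 0 := fun h0 => hza (by rw [← h5, h0, zero_mul])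
    simp only [smul_eq_mul]
    rw [← h5]
    have : u z ≠ 0 := fun h0 => hza (by rw [← h5, h0, mul_zero])
    field_simp
    ring
  | succ m ih =>
    -- Write `h(F) = h(0) + F * dslope h 0 (F)`: the constant contributes an exact derivative, and
    -- `dslope` shifts the Taylor coefficients by one.
    have hh' := hh.has_fpower_series_dslope_fslope
    filter_upwards [self_mem_nhdsWithin, ih hh', eventually_forall_closedBall hFu,
      eventually_forall_closedBall (hhF _ hh'.analyticAt),
      eventually_forall_closedBall hF.eventually_analyticAt] with r hr hi h1 h2 h3
    have hr : 0 < r := hr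
    have hFz (z) (hz : z ∈ sphere a r) : F z ≠ 0 := by
      have hza : z - a ≠ 0 := sub_ne_zero.2 (ne_of_mem_sphere hz hr.ne')
      intro h0
      exact hza (by rw [← h1 z (sphere_subset_closedBall hz), h0, zero_mul])
    have hFd (z) (hz : z ∈ sphere a r) : AnalyticAt ℂ F z := h3 z (sphere_subset_closedBall hz)
    rw [FormalMultilinearSeries.coeff_fslope] at hi
    rw [← hi]
    have h0 : (∮ z in C(a, r), h 0 * (deriv F z / F z ^ (m + 2))) = 0 := by
      refine circleIntegral.integral_eq_zero_of_hasDerivWithinAt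
        (f := fun z => h 0 * (-(F z ^ (m + 1))⁻¹ / (m + 1))) hr.le fun z hz => ?_
      have hd := ((((hFd z hz).differentiableAt.hasDerivAt.pow (m + 1)).inv
        (pow_ne_zero _ (hFz z hz))).neg.div_const ((m : ℂ) + 1)).const_mul (h 0)
      refine HasDerivAt.hasDerivWithinAt (hd.congr_deriv ?_)
      have := hFz z hz
      have hm : (m : ℂ) + 1 ≠ 0 := by exact_mod_cast m.succ_ne_zero
      push_cast
      simp only [Pi.pow_apply]
      field_simp
      ring
    have hi1 : CircleIntegrable (fun z => h 0 * (deriv F z / F z ^ (m + 2))) a r := by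
      refine ContinuousOn.circleIntegrable hr.le fun z hz => ContinuousAt.continuousWithinAt ?_
      exact continuousAt_const.mul ((hFd z hz).deriv.continuousAt.div
        ((hFd z hz).continuousAt.pow _) (pow_ne_zero _ (hFz z hz)))
    have hi2 : CircleIntegrable
        (fun z => dslope h 0 (F z) * deriv F z / F z ^ (m + 1)) a r := by
      refine ContinuousOn.circleIntegrable hr.le fun z hz => ContinuousAt.continuousWithinAt ?_
      exact ((ContinuousAt.comp (h2 z (sphere_subset_closedBall hz)).continuousAt
        (hFd z hz).continuousAt).mul (hFd z hz).deriv.continuousAt).div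
        ((hFd z hz).continuousAt.pow _) (pow_ne_zero _ (hFz z hz))
    have hadd := circleIntegral.integral_add hi1 hi2
    rw [h0, zero_add] at hadd
    rw [← hadd]
    refine circleIntegral.integral_congr hr.le fun z hz => ?_
    have hs := sub_smul_dslope h 0 (F z)
    rw [sub_zero, smul_eq_mul] at hs
    have := hFz z hz
    have : h (F z) = h 0 + F z * dslope h 0 (F z) := by rw [hs]; ring
    simp only [this]
    field_simp
    ring

/-- The coefficients of the Lagrange inversion series: `D^(m-1) u^m (a) / m!`. -/
noncomputable def coeff (u : ℂ → ℂ) (a : ℂ) (m : ℕ) : ℂ :=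
  iteratedDeriv (m - 1) (fun z => u z ^ m) a / (m ! : ℂ)

/-- **Lagrange inversion formula** for the Taylor coefficients of a local inverse. -/
theorem coeff_localInverse (hF : AnalyticAt ℂ F a) (hu : AnalyticAt ℂ u a)
    (hu0 : u a ≠ 0) (hFu : ∀ᶠ z in 𝓝 a, F z * u z = z - a) (hG : HasFPowerSeriesAt G p 0)
    (hGF : ∀ᶠ z in 𝓝 a, G (F z) = z) (m : ℕ) :
    p.coeff (m + 1) = coeff u a (m + 1) := by
  obtain ⟨r, hr, h1, h2, h3, h4, h5⟩ := ((eventually_mem_nhdsWithin (a := (0 : ℝ)) (s := Set.Ioi 0)).and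
    ((eventually_circleIntegral_comp_eq_coeff hF hu hu0 hFu hG (m + 1)).and
    ((eventually_forall_closedBall hFu).and ((eventually_forall_closedBall hGF).and
    ((eventually_forall_closedBall hF.eventually_analyticAt).and
    (eventually_forall_closedBall hu.eventually_analyticAt)))))).exists
  have hr : 0 < r := hr
  have hza (z) (hz : z ∈ sphere a r) : z - a ≠ 0 := sub_ne_zero.2 (ne_of_mem_sphere hz hr.ne')
  have hFz (z) (hz : z ∈ sphere a r) : F z ≠ 0 := fun h0 =>
    hza z hz (by rw [← h2 z (sphere_subset_closedBall hz), h0, zero_mul])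
  have hFd (z) (hz : z ∈ sphere a r) : AnalyticAt ℂ F z := h4 z (sphere_subset_closedBall hz)
  have hm : (m : ℂ) + 1 ≠ 0 := by exact_mod_cast m.succ_ne_zero
  have hd : DifferentiableOn ℂ (fun z => u z ^ (m + 1)) (closedBall a r) := fun z hz =>
    ((h5 z hz).differentiableAt.pow _).differentiableWithinAt
  have hC := hd.circleIntegral_one_div_sub_center_pow_smul hr m
  -- Integration by parts: as `G(F z) = z`, the integrand is the derivative of `z / F^(m+1)`.
  have hparts : (∮ z in C(a, r), ((F z ^ (m + 1))⁻¹ -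
      (m + 1) * (G (F z) * deriv F z / F z ^ (m + 1 + 1)))) = 0 := by
    refine circleIntegral.integral_eq_zero_of_hasDerivWithinAt
      (f := fun z => z * (F z ^ (m + 1))⁻¹) hr.le fun z hz => ?_
    have hd := (hasDerivAt_id z).mul (((hFd z hz).differentiableAt.hasDerivAt.pow (m + 1)).inv
        (pow_ne_zero _ (hFz z hz)))
    refine HasDerivAt.hasDerivWithinAt (hd.congr_deriv ?_)
    have := hFz z hz
    rw [h3 z (sphere_subset_closedBall hz)]
    push_cast
    simp only [Pi.pow_apply, Pi.inv_apply, id]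
    field_simp
    ring
  rw [circleIntegral.integral_sub] at hparts
  · have e1 : (∮ z in C(a, r), (F z ^ (m + 1))⁻¹) =
        ∮ z in C(a, r), (1 / (z - a) ^ (m + 1)) • u z ^ (m + 1) := by
      refine circleIntegral.integral_congr hr.le fun z hz => ?_
      have h6 := h2 z (sphere_subset_closedBall hz)
      have huz : u z ≠ 0 := fun h0 => hza z hz (by rw [← h6, h0, mul_zero])
      have := hFz z hz
      simp only [smul_eq_mul]
      rw [← h6, mul_pow]
      field_simp
    have e2 := circleIntegral.integral_const_mul ((m : ℂ) + 1)
      (fun z => G (F z) * deriv F z / F z ^ (m + 1 + 1)) a r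
    rw [e2, e1, hC, h1, smul_eq_mul] at hparts
    have hpi : (2 * π * I : ℂ) ≠ 0 := two_pi_I_ne_zero
    rw [coeff, Nat.add_sub_cancel, Nat.factorial_succ]
    push_cast
    have hf : (m ! : ℂ) ≠ 0 := by exact_mod_cast m.factorial_ne_zero
    field_simp
    field_simp at hparts
    rw [mul_zero] at hparts
    linear_combination -(mul_eq_zero.1 hparts).resolve_left hpi
  · refine ContinuousOn.circleIntegrable hr.le fun z hz => ContinuousAt.continuousWithinAt ?_
    exact ((hFd z hz).continuousAt.pow _).inv₀ (pow_ne_zero _ (hFz z hz))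
  · refine ContinuousOn.circleIntegrable hr.le fun z hz => ContinuousWithinAt.congr (f := fun z =>
      (m + 1) * (z * deriv F z / F z ^ (m + 1 + 1))) (ContinuousAt.continuousWithinAt ?_) ?_ ?_
    · exact continuousAt_const.mul ((continuousAt_id.mul (hFd z hz).deriv.continuousAt).div
        ((hFd z hz).continuousAt.pow _) (pow_ne_zero _ (hFz z hz)))
    · intro z hz
      simp only [h3 z (sphere_subset_closedBall hz)]
    · simp only [h3 z (sphere_subset_closedBall hz)]

variable {w : ℂ} {r M : ℝ}

/-- Cauchy's estimate for the `m`-th derivative of `u^(m+1)`; the leftover factor `m! / (m+1)!` is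
simply bounded by 1. -/
lemma norm_coeff_le (hr : 0 < r) (hM : 0 < M) (hu : DiffContOnCl ℂ u (ball a r))
    (huM : ∀ z ∈ sphere a r, ‖u z‖ ≤ M) (m : ℕ) :
    ‖coeff u a (m + 1)‖ ≤ r * (M / r) ^ (m + 1) := by
  have h1 : DiffContOnCl ℂ (fun z => u z ^ (m + 1)) (ball a r) := ⟨hu.1.pow _, hu.2.pow _⟩
  have h2 := norm_iteratedDeriv_le_of_forall_mem_sphere_norm_le m hr h1
    (C := M ^ (m + 1)) fun z hz => by
      rw [norm_pow]
      exact pow_le_pow_left₀ (norm_nonneg _) (huM z hz) _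
  rw [coeff, Nat.add_sub_cancel, norm_div, norm_natCast]
  have hf : (0 : ℝ) < (m ! : ℝ) := by exact_mod_cast m.factorial_pos
  calc _ ≤ (m ! : ℝ) * M ^ (m + 1) / r ^ m / ((m + 1)! : ℝ) := by gcongr
    _ ≤ (m ! : ℝ) * M ^ (m + 1) / r ^ m / (m ! : ℝ) := by
        gcongr
        exact m.le_succ
    _ = r * (M / r) ^ (m + 1) := by
        rw [div_pow, pow_succ r]
        field_simp

/-- The Lagrange inversion series. -/
noncomputable def series (u : ℂ → ℂ) (a w : ℂ) : ℂ :=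
  a + ∑' m : ℕ, coeff u a (m + 1) * w ^ (m + 1)

lemma exists_summable_bound (hr : 0 < r) (hM : 0 < M) (hu : DiffContOnCl ℂ u (ball a r))
    (huM : ∀ z ∈ sphere a r, ‖u z‖ ≤ M) {ρ : ℝ} (hρ0 : 0 ≤ ρ) (hρ : ρ < r / M) :
    ∃ b : ℕ → ℝ, Summable b ∧
      ∀ m w, ‖w‖ ≤ ρ → ‖coeff u a (m + 1) * w ^ (m + 1)‖ ≤ b m := by
  refine ⟨fun m => r * (M / r * ρ) ^ (m + 1), ?_, fun m w hw => ?_⟩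
  · refine Summable.mul_left r ((summable_nat_add_iff 1).2
      (summable_geometric_of_lt_one (by positivity) ?_))
    rw [lt_div_iff₀ hM] at hρ
    rw [div_mul_eq_mul_div, div_lt_one hr]
    linarith
  · rw [norm_mul, norm_pow]
    beta_reduce
    rw [mul_pow, ← mul_assoc]
    gcongr
    exact norm_coeff_le hr hM hu huM m

lemma summable_coeff (hr : 0 < r) (hM : 0 < M) (hu : DiffContOnCl ℂ u (ball a r))
    (huM : ∀ z ∈ sphere a r, ‖u z‖ ≤ M) (hw : ‖w‖ < r / M) :
    Summable fun m : ℕ => coeff u a (m + 1) * w ^ (m + 1) := by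
  obtain ⟨b, hb, hle⟩ := exists_summable_bound hr hM hu huM (norm_nonneg w) hw
  exact Summable.of_norm_bounded hb fun m => hle m w le_rfl

lemma differentiableOn_series (hr : 0 < r) (hM : 0 < M) (hu : DiffContOnCl ℂ u (ball a r))
    (huM : ∀ z ∈ sphere a r, ‖u z‖ ≤ M) :
    DifferentiableOn ℂ (series u a) (ball 0 (r / M)) := by
  intro w hw
  obtain ⟨ρ, hwρ, hρ⟩ := exists_between (mem_ball_zero_iff.1 hw)
  obtain ⟨b, hb, hle⟩ := exists_summable_bound hr hM hu huM ((norm_nonneg w).trans hwρ.le) hρ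
  have hd := differentiableOn_tsum_of_summable_norm hb
    (F := fun m w => coeff u a (m + 1) * w ^ (m + 1)) (U := ball 0 ρ)
    (fun m => by fun_prop) isOpen_ball fun m w hw => hle m w (mem_ball_zero_iff.1 hw).le
  exact ((hd.differentiableAt (isOpen_ball.mem_nhds (mem_ball_zero_iff.2 hwρ))).const_add
    a).differentiableWithinAt

/-- The Lagrange inversion series inverts an entire function `F` on the whole disc on which
Cauchy's estimate guarantees its convergence. -/
theorem apply_series (hF : Differentiable ℂ F) (hr : 0 < r) (hM : 0 < M)
    (hu : DiffContOnCl ℂ u (ball a r)) (huM : ∀ z ∈ sphere a r, ‖u z‖ ≤ M) (hu0 : u a ≠ 0)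
    (hFu : ∀ᶠ z in 𝓝 a, F z * u z = z - a) (hw : ‖w‖ < r / M) : F (series u a w) = w := by
  have hFa := apply_eq_zero hu0 hFu
  have hFan := hF.analyticAt a
  have huan : AnalyticAt ℂ u a := hu.1.analyticAt (ball_mem_nhds a hr)
  have hF' : deriv F a ≠ 0 := left_ne_zero_of_mul_eq_one (deriv_mul_eq_one hFan huan hu0 hFu)
  have hst := hFan.hasStrictDerivAt
  set G := hst.localInverse F _ a hF' with hGdef
  have hGF : ∀ᶠ z in 𝓝 a, G (F z) = z := hst.eventually_left_inverse hF'
  have hFG : ∀ᶠ w in 𝓝 0, F (G w) = w := by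
    have := hst.eventually_right_inverse hF'
    rwa [hFa] at this
  have hG : AnalyticAt ℂ G 0 := by
    have := (hFan.contDiffAt (n := ⊤)).to_localInverse
      (hst.hasStrictFDerivAt_equiv hF').hasFDerivAt (by simp)
    rw [hFa] at this
    exact this.analyticAt
  obtain ⟨p, hp⟩ := hG
  have hGS : series u a =ᶠ[𝓝 0] G := by
    filter_upwards [hasFPowerSeriesAt_iff.1 hp] with z hz
    rw [zero_add] at hz
    have h0 : p.coeff 0 = a := by
      rw [show p.coeff 0 = G 0 from hp.coeff_zero 1, ← hFa]
      exact hGF.self_of_nhds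
    have := (hasSum_nat_add_iff' 1).2 hz
    simp only [sum_range_one, pow_zero, h0,
      coeff_localInverse hFan huan hu0 hFu hp hGF, smul_eq_mul] at this
    rw [series]
    simp_rw [mul_comm (coeff u a _)]
    rw [this.tsum_eq]
    ring
  have hS := differentiableOn_series hr hM hu huM
  -- The series agrees with the local inverse only near 0; the identity theorem extends `F ∘ series
  -- = id` to the whole disc.
  have h1 : AnalyticOnNhd ℂ (fun w => F (series u a w)) (ball 0 (r / M)) :=
    (hF.comp_differentiableOn hS).analyticOnNhd isOpen_ball
  refine h1.eqOn_of_preconnected_of_eventuallyEq analyticOnNhd_id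
    (convex_ball _ _).isPreconnected (mem_ball_self (by positivity)) ?_ (mem_ball_zero_iff.2 hw)
  filter_upwards [hGS, hFG] with z h1 h2
  rw [h1, h2]

end LagrangeInversion

/-! ### Identification of the Lagrange coefficients with the Bessel-polynomial terms. -/

namespace URLLC

open Complex

/-- The Lagrange inversion kernel of `e ^ z (z - ι₁) (z - ι₂)` at `ι₁`. -/
noncomputable def lambertKernel (ι₂ z : ℂ) : ℂ := exp (-z) * (z - ι₂)⁻¹

/-- This falling factorial is the coefficient in the `k`-th derivative of `z^(-(n+1))`. -/
lemma prod_neg_succ_sub (n k : ℕ) :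
    ∏ j ∈ range k, (((-(n + 1 : ℕ) : ℤ) : ℂ) - j) = (-1) ^ k * ((n + k)! : ℂ) / (n ! : ℂ) := by
  have hn : (n ! : ℂ) ≠ 0 := by exact_mod_cast n.factorial_ne_zero
  induction k with
  | zero => simp [hn]
  | succ k ih =>
    rw [prod_range_succ, ih, ← add_assoc, Nat.factorial_succ]
    push_cast
    field_simp
    ring

lemma iteratedDeriv_lambertKernel_pow {ι₂ z : ℂ} (hz : z - ι₂ ≠ 0) (n : ℕ) :
    iteratedDeriv n (fun z => lambertKernel ι₂ z ^ (n + 1)) z =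
      ∑ k ∈ range (n + 1), n.choose k *
        ((-1) ^ k * ((n + k)! : ℂ) / (n ! : ℂ) * ((z - ι₂) ^ (n + 1 + k))⁻¹) *
        ((-(n + 1)) ^ (n - k) * exp (-z) ^ (n + 1)) := by
  have h1 : (fun z => lambertKernel ι₂ z ^ (n + 1)) =
      fun z => (z - ι₂) ^ (-(n + 1 : ℕ) : ℤ) * exp (-(n + 1) * z) := by
    funext z
    rw [lambertKernel, mul_pow, ← exp_nat_mul, zpow_neg, zpow_natCast, inv_pow, mul_comm]
    push_cast
    ring_nf
  have h2 : ContDiffAt ℂ n (fun z => (z - ι₂) ^ (-(n + 1 : ℕ) : ℤ)) z := by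
    simp_rw [zpow_neg, zpow_natCast]
    exact ((contDiffAt_id.sub contDiffAt_const).pow _).inv (pow_ne_zero _ hz)
  rw [h1, iteratedDeriv_fun_mul h2 (by fun_prop)]
  refine sum_congr rfl fun k _ => ?_
  rw [iteratedDeriv_cexp_const_mul,
    iteratedDeriv_comp_sub_const k (fun z : ℂ => z ^ (-(n + 1 : ℕ) : ℤ)), iteratedDeriv_eq_iterate]
  beta_reduce
  rw [iter_deriv_zpow, prod_neg_succ_sub, ← exp_nat_mul]
  rw [show (-(n + 1 : ℕ) : ℤ) - (k : ℤ) = -((n + 1 + k : ℕ) : ℤ) by push_cast; ring, zpow_neg,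
    zpow_natCast]
  push_cast
  ring_nf

/-- The Leibniz sum for `(z - ι₂)^(-(n+1)) * e^(-(n+1)z)` is the Bessel polynomial. The signs
`(-1)^k` from the power, `(-1)^(n-k)` from the exponential and `(-1)^(n+1)` from replacing `ι₂ - ι₁`
by `ι₁ - ι₂` multiply to `-1`. -/
lemma coeff_lambertKernel_mul_pow {ι₁ ι₂ : ℝ} (h : ι₁ ≠ ι₂) (μ : ℝ) (n : ℕ) :
    LagrangeInversion.coeff (lambertKernel ι₂) ι₁ (n + 1) * (μ : ℂ) ^ (n + 1) =
      -((lambertTerm ι₁ ι₂ μ (n + 1) : ℝ) : ℂ) := by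
  have hd : (ι₁ : ℂ) - ι₂ ≠ 0 := sub_ne_zero.2 (by exact_mod_cast h)
  have hd' : (ι₂ : ℂ) - ι₁ ≠ 0 := sub_ne_zero.2 (by exact_mod_cast h.symm)
  rw [LagrangeInversion.coeff, Nat.add_sub_cancel, iteratedDeriv_lambertKernel_pow hd, lambertTerm,
    besselPoly, Nat.add_sub_cancel]
  push_cast
  rw [sum_div, sum_mul, mul_sum, ← sum_neg_distrib]
  refine sum_congr rfl fun k hk => ?_
  obtain ⟨j, rfl⟩ := Nat.exists_eq_add_of_le (Nat.lt_succ_iff.1 (mem_range.1 hk))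
  rw [Nat.cast_choose ℂ (Nat.le_add_right k j), Nat.add_sub_cancel_left]
  have f1 : (k ! : ℂ) ≠ 0 := by exact_mod_cast k.factorial_ne_zero
  have f2 : (j ! : ℂ) ≠ 0 := by exact_mod_cast j.factorial_ne_zero
  have f3 : ((k + j)! : ℂ) ≠ 0 := by exact_mod_cast (k + j).factorial_ne_zero
  have f4 : ((k + j + 1)! : ℂ) ≠ 0 := by exact_mod_cast (k + j + 1).factorial_ne_zero
  have f5 : ((k : ℂ) + j + 1) ≠ 0 := by exact_mod_cast (k + j).succ_ne_zero
  push_cast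
  rw [← neg_sub (ι₁ : ℂ) ι₂]
  generalize (ι₁ : ℂ) - ι₂ = d at hd
  generalize ((k : ℂ) + j + 1) = N at f5
  rw [show (-2 / (N * -d) / 2 : ℂ) = (N * d)⁻¹ by field_simp,
    show (μ : ℂ) * N * exp (-ι₁) / -d = -(μ * N * exp (-ι₁) * d⁻¹) by field_simp,
    neg_pow N j, neg_pow (_ * d⁻¹)]
  simp only [mul_pow, inv_pow, pow_add, pow_one, mul_inv]
  field_simp

lemma ofReal_lambertW {ι₁ ι₂ : ℝ} (h : ι₁ ≠ ι₂) (μ : ℝ) :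
    ((lambertW ι₁ ι₂ μ : ℝ) : ℂ) = LagrangeInversion.series (lambertKernel ι₂) ι₁ μ := by
  simp_rw [LagrangeInversion.series, coeff_lambertKernel_mul_pow h, tsum_neg, lambertW]
  push_cast
  ring

end URLLC

/-! ### Kernel bounds on discs tangent to the line `re z = s`, and their consequences for the
series. -/

namespace URLLC

open Metric

section Analytic

variable {a s t : ℝ}

lemma le_re_of_mem_closedBall {z : ℂ} (hz : z ∈ closedBall (a : ℂ) (a - s)) : s ≤ z.re := by
  have h1 := (Complex.abs_re_le_norm (z - a)).trans (mem_closedBall_iff_norm.1 hz)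
  rw [Complex.sub_re, Complex.ofReal_re] at h1
  linarith [(abs_le.1 h1).1]

lemma add_le_norm_sub_neg {z : ℂ} (hz : z ∈ closedBall (a : ℂ) (a - s)) :
    a + s ≤ ‖z - ((-a : ℝ) : ℂ)‖ := by
  have h1 := (Complex.re_le_norm (z - ((-a : ℝ) : ℂ)))
  rw [Complex.sub_re, Complex.ofReal_re] at h1
  linarith [le_re_of_mem_closedBall hz]

lemma sub_neg_ne_zero (has : 0 < a + s) {z : ℂ} (hz : z ∈ closedBall (a : ℂ) (a - s)) :
    z - ((-a : ℝ) : ℂ) ≠ 0 :=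
  norm_pos_iff.1 (has.trans_le (add_le_norm_sub_neg hz))

lemma diffContOnCl_lambertKernel (has : 0 < a + s) :
    DiffContOnCl ℂ (lambertKernel ((-a : ℝ) : ℂ)) (ball (a : ℂ) (a - s)) := by
  refine DifferentiableOn.diffContOnCl (DifferentiableOn.mono (t := closedBall (a : ℂ) (a - s))
    (fun z hz => DifferentiableAt.differentiableWithinAt ?_) closure_ball_subset_closedBall)
  exact (differentiableAt_id.neg.cexp).mul
    ((differentiableAt_id.sub_const _).inv (sub_neg_ne_zero has hz))

lemma norm_lambertKernel_le (has : 0 < a + s) {z : ℂ} (hz : z ∈ closedBall (a : ℂ) (a - s)) :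
    ‖lambertKernel ((-a : ℝ) : ℂ) z‖ ≤ Real.exp (-s) * (a + s)⁻¹ := by
  rw [lambertKernel, norm_mul, norm_inv, Complex.norm_exp, Complex.neg_re]
  have := le_re_of_mem_closedBall hz
  have := add_le_norm_sub_neg hz
  gcongr

/-- The guaranteed radius `r / M` equals `|F s|`: both kernel bounds are attained at the tangency
point `z = s`. -/
lemma div_kernel_bound : (a - s) / (Real.exp (-s) * (a + s)⁻¹) =
    Real.exp s * (a ^ 2 - s ^ 2) := by
  rw [Real.exp_neg, div_eq_mul_inv, mul_inv, inv_inv, inv_inv]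
  ring

lemma summable_lambertTerm (has : 0 < a + s) (hsa : s < a)
    (ht : |t| < Real.exp s * (a ^ 2 - s ^ 2)) :
    Summable fun j : ℕ => lambertTerm a (-a) t (j + 1) := by
  have h := LagrangeInversion.summable_coeff (w := t) (sub_pos.2 hsa) (by positivity)
    (diffContOnCl_lambertKernel has)
    (fun z hz => norm_lambertKernel_le has (sphere_subset_closedBall hz))
    (by rwa [div_kernel_bound, Complex.norm_real, Real.norm_eq_abs])
  simp_rw [coeff_lambertKernel_mul_pow (show a ≠ -a by linarith), ← Complex.ofReal_neg] at h
  exact summable_neg_iff.1 (Complex.summable_ofReal.1 h)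

lemma exp_lambertW_mul (has : 0 < a + s) (hsa : s < a)
    (ht : |t| < Real.exp s * (a ^ 2 - s ^ 2)) :
    Real.exp (lambertW a (-a) t) * (lambertW a (-a) t - a) * (lambertW a (-a) t + a) = t := by
  have hane : (a : ℂ) - ((-a : ℝ) : ℂ) ≠ 0 := by
    rw [sub_ne_zero]
    exact_mod_cast (show a ≠ -a by linarith)
  have h := LagrangeInversion.apply_series (w := t)
    (F := fun z => Complex.exp z * (z - a) * (z - ((-a : ℝ) : ℂ))) (by fun_prop)
    (sub_pos.2 hsa) (by positivity) (diffContOnCl_lambertKernel has)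
    (fun z hz => norm_lambertKernel_le has (sphere_subset_closedBall hz))
    (mul_ne_zero (Complex.exp_ne_zero _) (inv_ne_zero hane))
    (by
      filter_upwards [closedBall_mem_nhds (a : ℂ) (sub_pos.2 hsa)] with z hz
      have := sub_neg_ne_zero has hz
      rw [lambertKernel, Complex.exp_neg]
      have := Complex.exp_ne_zero z
      field_simp)
    (by rwa [div_kernel_bound, Complex.norm_real, Real.norm_eq_abs])
  rw [← ofReal_lambertW (show a ≠ -a by linarith)] at h
  have h' : Real.exp (lambertW a (-a) t) * (lambertW a (-a) t - a) *
    (lambertW a (-a) t - (-a)) = t := by exact_mod_cast h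
  rwa [sub_neg_eq_add] at h'

lemma continuousOn_lambertW (has : 0 < a + s) (hsa : s < a) :
    ContinuousOn (lambertW a (-a)) {t | |t| < Real.exp s * (a ^ 2 - s ^ 2)} := by
  have h := (LagrangeInversion.differentiableOn_series (sub_pos.2 hsa) (by positivity)
    (diffContOnCl_lambertKernel has)
    (fun z hz => norm_lambertKernel_le has (sphere_subset_closedBall hz))).continuousOn
  have h2 : lambertW a (-a) = fun t : ℝ =>
      (LagrangeInversion.series (lambertKernel ((-a : ℝ) : ℂ)) a t).re := by
    funext t
    rw [← ofReal_lambertW (show a ≠ -a by linarith), Complex.ofReal_re]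
  rw [h2]
  refine Complex.continuous_re.comp_continuousOn
    (h.comp Complex.continuous_ofReal.continuousOn fun t ht => ?_)
  rw [div_kernel_bound, mem_ball_zero_iff, Complex.norm_real]
  exact ht

lemma lambertW_zero (ι₁ ι₂ : ℝ) : lambertW ι₁ ι₂ 0 = ι₁ := by
  simp [lambertW, lambertTerm]

end Analytic

/-! ### Location of the branch, uniqueness of the positive root, and the rate equation. -/

/-- The branch `𝓦(a, -a; ·)` stays to the right of every vertical line `re z = s` on which
`|e ^ z (z - a) (z + a)|` exceeds the modulus of the argument. -/
lemma lt_lambertW {a s t : ℝ} (has : 0 < a + s) (hsa : s < a) (ht0 : t ≤ 0)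
    (ht : -t < Real.exp s * (a ^ 2 - s ^ 2)) : s < lambertW a (-a) t := by
  have habs {x : ℝ} (hx : x ∈ Set.Icc t 0) : |x| < Real.exp s * (a ^ 2 - s ^ 2) := by
    rw [abs_of_nonpos hx.2]
    linarith [hx.1]
  by_contra! hle
  have hc : ContinuousOn (lambertW a (-a)) (Set.Icc t 0) :=
    (continuousOn_lambertW has hsa).mono fun x hx => habs hx
  -- A crossing of the level `s` at `x` would force `x = -e^s (a² - s²)`, outside the allowed range.
  obtain ⟨x, hx, hxs⟩ := intermediate_value_Icc ht0 hc
    ⟨hle, by rw [lambertW_zero]; exact hsa.le⟩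
  have h := exp_lambertW_mul has hsa (habs hx)
  rw [hxs] at h
  linarith [hx.1]

lemma exists_sq_lt_exp_mul {a : ℝ} (ha : 0 < a) :
    ∃ s, 0 < s ∧ s < a ∧ a ^ 2 < Real.exp s * (a ^ 2 - s ^ 2) := by
  -- The choice `s (1 + 2a) = a²` gives `(1 + s)(a² - s²) - a² = s² (2a - s) > 0`. Taking `s = 0`
  -- would miss the case `α = 0`, where `|μ| = a²`.
  have hs : 0 < a ^ 2 / (1 + 2 * a) := by positivity
  have hsm : a ^ 2 / (1 + 2 * a) * (1 + 2 * a) = a ^ 2 := by field_simp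
  generalize a ^ 2 / (1 + 2 * a) = s at hs hsm
  have hsa : s < a := by nlinarith
  refine ⟨s, hs, hsa, ?_⟩
  have h1 : 0 < a ^ 2 - s ^ 2 := by nlinarith
  have h2 := Real.add_one_le_exp s
  calc a ^ 2 < (s + 1) * (a ^ 2 - s ^ 2) := by nlinarith [mul_pos hs (sub_pos.2 hsa)]
    _ ≤ _ := by gcongr

/-- `e ^ κ (a² - κ²)` takes each value in `(0, a²]` at most once for `κ > 0`. -/
lemma eq_of_exp_mul_eq {a c x y : ℝ} (hc0 : 0 ≤ c) (hc : c ≤ a ^ 2) (hx : 0 < x) (hy : 0 < y)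
    (hxc : Real.exp x * (x - a) * (x + a) = -c) (hyc : Real.exp y * (y - a) * (y + a) = -c) :
    x = y := by
  wlog hxy : x < y generalizing x y
  · by_contra hne
    exact hne (this hy hx hyc hxc (lt_of_le_of_ne (not_lt.1 hxy) (Ne.symm hne))).symm
  exfalso
  have hexp (z : ℝ) (hz : Real.exp z * (z - a) * (z + a) = -c) :
      c * Real.exp (-z) = a ^ 2 - z ^ 2 := by
    rw [Real.exp_neg]
    have := Real.exp_ne_zero z
    field_simp
    linarith
  -- The point `-x` lies between `-y` and `0`. Convexity, multiplied by `c ≤ a²`, yields `a² - x² ≤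
  -- a² - x y`, which contradicts `x < y`.
  have hconv := convexOn_exp.2 (Set.mem_univ 0) (Set.mem_univ (-y))
    (show 0 ≤ 1 - x / y by rw [sub_nonneg, div_le_one hy]; exact hxy.le)
    (show 0 ≤ x / y by positivity) (by ring)
  have hxy' : x / y * -y = -x := by field_simp
  simp only [smul_eq_mul, mul_zero, zero_add, Real.exp_zero, mul_one, hxy'] at hconv
  have h1 := mul_le_mul_of_nonneg_left hconv hc0
  rw [hexp x hxc, mul_add, mul_left_comm, hexp y hyc] at h1
  have hl : x / y < 1 := (div_lt_one hy).2 hxy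
  have h2 : c * (1 - x / y) ≤ a ^ 2 * (1 - x / y) := by gcongr
  have h3 : x / y * y ^ 2 = x * y := by field_simp
  nlinarith [mul_pos hx (sub_pos.2 hxy)]

/-- With `1 + γ = e ^ (α + κ / 2)`, the rate equation becomes a transcendental equation for `κ`. -/
lemma rate_eq_iff {ϑ α κ : ℝ} (hϑ : 0 < ϑ) (hκ : 0 ≤ α + κ / 2) :
    rate ϑ (Real.exp (α + κ / 2) - 1) = α ↔ 0 ≤ κ ∧
      Real.exp κ * (κ - 2 * ϑ) * (κ + 2 * ϑ) = -4 * Real.exp (-2 * α) * ϑ ^ 2 := by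
  have hV : dispersion (Real.exp (α + κ / 2) - 1) = 1 - Real.exp (-2 * α) * (Real.exp κ)⁻¹ := by
    rw [dispersion, add_sub_cancel, ← Real.exp_nat_mul, one_div, ← Real.exp_neg, ← Real.exp_neg,
      ← Real.exp_add]
    push_cast
    ring_nf
  have hV0 : 0 ≤ 1 - Real.exp (-2 * α) * (Real.exp κ)⁻¹ := by
    rw [← Real.exp_neg, ← Real.exp_add, sub_nonneg, Real.exp_le_one_iff]
    linarith
  have hexp := Real.exp_pos κ
  rw [rate, hV, capacity, add_sub_cancel, Real.log_exp]
  have h1 : α + κ / 2 - ϑ * √(1 - Real.exp (-2 * α) * (Real.exp κ)⁻¹) = α ↔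
      √(1 - Real.exp (-2 * α) * (Real.exp κ)⁻¹) = κ / (2 * ϑ) := by
    rw [eq_div_iff (by positivity)]
    constructor <;> intro h <;> linarith
  have h2 : Real.exp κ * (κ - 2 * ϑ) * (κ + 2 * ϑ) = -4 * Real.exp (-2 * α) * ϑ ^ 2 ↔
      1 - Real.exp (-2 * α) * (Real.exp κ)⁻¹ = (κ / (2 * ϑ)) ^ 2 := by
    field_simp
    constructor <;> intro h <;> linarith
  rw [h1, h2]
  constructor
  · intro h
    -- The sign condition on `κ` is exactly what makes squaring reversible.
    have h0 : 0 ≤ κ / (2 * ϑ) := h ▸ Real.sqrt_nonneg _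
    refine ⟨?_, by rw [← h, Real.sq_sqrt hV0]⟩
    have := mul_nonneg h0 (show 0 ≤ 2 * ϑ by positivity)
    rwa [div_mul_cancel₀ _ (by positivity)] at this
  · rintro ⟨h0, h⟩
    rw [h, Real.sqrt_sq (by positivity)]

end URLLC

/-! ### Assembly. -/

theorem theorem2 (ϑ α : ℝ) (hϑ : 0 < ϑ) (hα : 0 ≤ α) :
    -- the series defining `𝓦(2ϑ, -2ϑ; -4 e^{-2α} ϑ²)` converges,
    Summable (fun j : ℕ =>
      URLLC.lambertTerm (2 * ϑ) (-2 * ϑ) (-4 * Real.exp (-2 * α) * ϑ ^ 2) (j + 1)) ∧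
    let κs : ℝ := URLLC.lambertW (2 * ϑ) (-2 * ϑ) (-4 * Real.exp (-2 * α) * ϑ ^ 2)
    -- its value is the solution in `(0, 2ϑ]` of the transcendental equation,
    (∀ κ : ℝ, (0 < κ ∧ κ ≤ 2 * ϑ ∧
        Real.exp κ * (κ - 2 * ϑ) * (κ + 2 * ϑ) = -4 * Real.exp (-2 * α) * ϑ ^ 2) ↔ κ = κs) ∧
    -- and it yields the solution of `R(γ) = α` in the range `γ > 0`.
    (∀ γ : ℝ, (0 < γ ∧ URLLC.rate ϑ γ = α) ↔ γ = Real.exp (α + κs / 2) - 1) := by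
  have ha : 0 < 2 * ϑ := by positivity
  obtain ⟨s, hs0, hsa, hs⟩ := URLLC.exists_sq_lt_exp_mul ha
  have has : 0 < 2 * ϑ + s := by positivity
  set μ := -4 * Real.exp (-2 * α) * ϑ ^ 2 with hμ
  have hE : Real.exp (-2 * α) ≤ 1 := Real.exp_le_one_iff.2 (by linarith)
  have hE0 := Real.exp_pos (-2 * α)
  have hμ0 : μ < 0 := by
    have : 0 < Real.exp (-2 * α) * ϑ ^ 2 := by positivity
    linarith
  have hμle : -μ ≤ (2 * ϑ) ^ 2 := by nlinarith [sq_nonneg ϑ]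
  have habs : |μ| < Real.exp s * ((2 * ϑ) ^ 2 - s ^ 2) := by
    rw [abs_of_neg hμ0]
    linarith
  rw [neg_mul 2 ϑ]
  refine ⟨URLLC.summable_lambertTerm has hsa habs, ?_⟩
  intro κs
  have hκ0 : 0 < κs := hs0.trans (URLLC.lt_lambertW has hsa hμ0.le (by linarith))
  have hκ : Real.exp κs * (κs - 2 * ϑ) * (κs + 2 * ϑ) = μ :=
    URLLC.exp_lambertW_mul has hsa habs
  have hκle : κs ≤ 2 * ϑ := by
    by_contra! h
    have : 0 < Real.exp κs * (κs - 2 * ϑ) * (κs + 2 * ϑ) :=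
      mul_pos (mul_pos (Real.exp_pos _) (sub_pos.2 h)) (by positivity)
    linarith
  have huniq (κ : ℝ) (h0 : 0 < κ) (h : Real.exp κ * (κ - 2 * ϑ) * (κ + 2 * ϑ) = μ) : κ = κs :=
    URLLC.eq_of_exp_mul_eq (c := -μ) (by linarith) hμle h0 hκ0 (by rw [h, neg_neg])
      (by rw [hκ, neg_neg])
  refine ⟨fun κ => ⟨fun h => huniq κ h.1 h.2.2, ?_⟩, fun γ => ⟨?_, ?_⟩⟩
  · rintro rfl
    exact ⟨hκ0, hκle, hκ⟩
  · rintro ⟨hγ, hR⟩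
    have hlog : 0 < Real.log (1 + γ) := Real.log_pos (by linarith)
    obtain ⟨κ, hκdef⟩ : ∃ κ, α + κ / 2 = Real.log (1 + γ) :=
      ⟨2 * (Real.log (1 + γ) - α), by ring⟩
    have hγκ : γ = Real.exp (α + κ / 2) - 1 := by
      rw [hκdef, Real.exp_log (by linarith)]
      ring
    rw [hγκ, URLLC.rate_eq_iff hϑ (by linarith)] at hR
    have hκpos : 0 < κ := by
      -- The root `κ = 0` would need `e^(-2α) = 1`, whereas `γ > 0` would then give `α = log (1 + γ)
      -- > 0`.
      refine lt_of_le_of_ne hR.1 fun h0 => ?_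
      have hV := hR.2
      rw [← h0, Real.exp_zero] at hV
      rw [← h0] at hκdef
      have : Real.exp (-2 * α) < 1 := by rw [Real.exp_lt_one_iff]; linarith
      nlinarith [sq_pos_of_pos hϑ]
    rw [hγκ, huniq κ hκpos hR.2]
  · rintro rfl
    refine ⟨?_, (URLLC.rate_eq_iff hϑ (by linarith)).2 ⟨hκ0.le, hκ⟩⟩
    rw [sub_pos]
    exact Real.one_lt_exp_iff.2 (by linarith)
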